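/- Let $\Omega\subset\mathbb{C}$ be a simply connected domain (non-empty, open, connected) with $0\notin\Omega$, and let $H(\Omega)$ be the space of holomorphic functions on $\Omega$ with the topology of uniform convergence on compact subsets of $\Omega$. For $f\in H(\Omega)$, $N\ge 0$, $\zeta\in\Omega$ and $z\in\mathbb{C}$ put $$S_N(f,\zeta)(z)=\sum_{n=0}^{N}\frac{f^{(n)}(\zeta)}{n!}(z-\zeta)^n,\qquad \widetilde T_N(f)(\zeta)=S_N(f,\zeta)(0)=\sum_{n=0}^{N}\frac{f^{(n)}(\zeta)}{n!}(-\zeta)^n .$$ Let $\widetilde S_0(\Omega)$ be the set of all $f\in H(\Omega)$ such that for every $c\in\mathbb{C}$ there is a sequence $(\lambda_n)$ in $\{0,1,2,\dots\}$ with $\sup_{\zeta\in L}|\widetilde T_{\lambda_n}(f)(\zeta)-c|\to 0$ as $n\to\infty$ for every compact set $L\subset\Omega$. Let $U(\Omega)$ be the set of all $f\in H(\Omega)$ such that for every compact set $K\subset\mathbb{C}$ with $K\cap\Omega=\emptyset$ and $\mathbb{C}\setminus K$ connected, and every function $h$ that is continuous on $K$ and holomorphic in the interior of $K$, there is a sequence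 $(\lambda_n)$ in $\{0,1,2,\dots\}$ with $\sup_{\zeta\in L}\sup_{z\in K}|S_{\lambda_n}(f,\zeta)(z)-h(z)|\to 0$ as $n\to\infty$ for every compact set $L\subset\Omega$. Then $\widetilde S_0(\Omega)$ contains a dense $G_\delta$ subset of $H(\Omega)$. Moreover, $U(\Omega)\subset\widetilde S_0(\Omega)$. -/

import Mathlib

open Filter Topology TopologicalSpace

noncomputable section

/-- The extension by zero to all of `ℂ` of a function defined on an open set `Ω ⊆ ℂ`. As `Ω` is
open, the values on `Ω` of derivatives of the extension depend only on the original function. -/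
def extendZero {Ω : Opens ℂ} (f : Ω → ℂ) : ℂ → ℂ :=
  Function.extend Subtype.val f 0

theorem extendZero_apply {Ω : Opens ℂ} (f : Ω → ℂ) (ζ : Ω) : extendZero f ζ = f ζ :=
  Subtype.val_injective.extend_apply f 0 ζ

/-- The space `H(Ω)` of holomorphic functions on the open set `Ω`, as a subspace of `C(Ω, ℂ)`
with the compact-open topology, i.e. with the topology of uniform convergence on the compact
subsets of `Ω`. -/
abbrev HolSpace (Ω : Opens ℂ) : Type :=
  {f : C(Ω, ℂ) // DifferentiableOn ℂ (extendZero f) Ω}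

/-- The Taylor partial sum `S_N(f, ζ)(z) = ∑_{n=0}^N f⁽ⁿ⁾(ζ) / n! * (z - ζ)^n` of `f ∈ H(Ω)`
with centre `ζ ∈ Ω`, evaluated at `z ∈ ℂ`. -/
def taylorSum {Ω : Opens ℂ} (N : ℕ) (f : HolSpace Ω) (ζ : Ω) (z : ℂ) : ℂ :=
  ∑ n ∈ Finset.range (N + 1),
    iteratedDeriv n (extendZero f.1) ζ / (n.factorial : ℂ) * (z - (ζ : ℂ)) ^ n

/-- `T̃_N(f)(ζ) = ∑_{n=0}^N f⁽ⁿ⁾(ζ) / n! * (-ζ)^n`, as a function of the centre `ζ ∈ Ω`. -/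
def centerSum {Ω : Opens ℂ} (N : ℕ) (f : HolSpace Ω) (ζ : Ω) : ℂ :=
  ∑ n ∈ Finset.range (N + 1),
    iteratedDeriv n (extendZero f.1) ζ / (n.factorial : ℂ) * (-(ζ : ℂ)) ^ n

/-- The class `S̃₀(Ω)`: for each constant `c` there is a sequence of indices along which the
functions `T̃_N(f)` converge to `c` uniformly on every compact subset of `Ω`. -/
def constUniversal (Ω : Opens ℂ) : Set (HolSpace Ω) :=
  {f | ∀ c : ℂ, ∃ l : ℕ → ℕ, ∀ L : Set Ω, IsCompact L →
    TendstoUniformlyOn (fun n ζ => centerSum (l n) f ζ) (fun _ => c) atTop L}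

/-- The class `U(Ω)` of universal Taylor series. -/
def universalTaylor (Ω : Opens ℂ) : Set (HolSpace Ω) :=
  {f | ∀ K : Set ℂ, IsCompact K → Disjoint K (Ω : Set ℂ) → IsConnected Kᶜ →
    ∀ h : ℂ → ℂ, ContinuousOn h K → DifferentiableOn ℂ h (interior K) →
    ∃ l : ℕ → ℕ, ∀ L : Set Ω, IsCompact L →
      TendstoUniformlyOn (fun n (p : Ω × ℂ) => taylorSum (l n) f p.1 p.2) (fun p => h p.2)
        atTop (L ×ˢ K)}

end

/-! For a polynomial `p`, the Taylor sum of order `p.natDegree` equals `p` whatever the centre, so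
its value at 0 is the constant `p(0)`. Since 0 is not in `Ω`, `(f - c) / z` is holomorphic there,
and Runge's theorem approximates it by a polynomial `q`; then `c + z q` is close to `f` and has
value `c` at 0. Hence the open sets `centerApprox` are dense, and Baire's theorem over a countable
family of them gives the dense Gδ set. The inclusion of `U(Ω)` is the case `K = {0}`, `h = c`.

Most of the work is Runge's theorem, through the spectrum `σ` of the coordinate in `P(K)`. The set
`σ \ K` is open, so if `σ` left `Ω` at `a`, some cutoff `φ` supported in `σ \ K` would equal 1 near
`σ \ Ω`, and its `dbar` would live in `Ω`. There `1 / (w - a)` is the derivative of a logarithm, so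
`∫ dbar φ / (w - a) = 0` by parts, while Cauchy–Pompeiu gives `-2π φ(a) ≠ 0`. Thus `σ ⊆ Ω`, and the
Cauchy–Pompeiu integral, with resolvents as kernels, exhibits `f` on `K` as an element of `P(K)`. -/

section

open MeasureTheory Complex Set

noncomputable section

/-! ### The Wirtinger derivative and the Cauchy–Pompeiu formula -/

/-- Twice the Wirtinger derivative `∂/∂z̄` of a function `g : ℂ → ℂ`. -/
def dbar (g : ℂ → ℂ) (w : ℂ) : ℂ := fderiv ℝ g w 1 + I * fderiv ℝ g w I

theorem dbar_eq_zero_of_fderiv_eq_zero {g : ℂ → ℂ} {w : ℂ} (h : fderiv ℝ g w = 0) :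
    dbar g w = 0 := by
  simp [dbar, h]

theorem continuous_dbar {g : ℂ → ℂ} (hg : ContDiff ℝ 1 g) : Continuous (dbar g) := by
  have h := hg.continuous_fderiv one_ne_zero
  unfold dbar
  fun_prop

theorem tsupport_dbar_subset (g : ℂ → ℂ) : tsupport (dbar g) ⊆ tsupport (fderiv ℝ g) :=
  closure_mono fun _ hw h => hw (dbar_eq_zero_of_fderiv_eq_zero h)

theorem contDiff_of_tsupport {g : ℂ → ℂ} {n : WithTop ℕ∞}
    (h : ∀ w ∈ tsupport g, ContDiffAt ℝ n g w) : ContDiff ℝ n g :=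
  contMDiff_iff_contDiff.mp (contMDiff_of_tsupport fun w hw => (h w hw).contMDiffAt)

/-- Multiplying by a holomorphic function commutes with `dbar`. -/
theorem dbar_mul_of_differentiableAt {φ f : ℂ → ℂ} {w : ℂ} (hφ : DifferentiableAt ℝ φ w)
    (hf : DifferentiableAt ℂ f w) : dbar (φ * f) w = dbar φ w * f w := by
  have hf' : HasFDerivAt f ((fderiv ℂ f w).restrictScalars ℝ) w :=
    hf.hasFDerivAt.restrictScalars ℝ
  have h1 : (fderiv ℂ f w) I = I * fderiv ℂ f w 1 := by
    simp
  rw [dbar, dbar, (hφ.hasFDerivAt.mul hf').fderiv]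
  simp only [add_apply, smul_apply,
    ContinuousLinearMap.coe_restrictScalars', smul_eq_mul, h1]
  linear_combination (φ w * fderiv ℂ f w 1) * I_mul_I

/-- For a real-linear `A`, the map `v ↦ A v + I * A (I * v)` is conjugate-linear, so a unit `v`
contributes the factor `v⁻¹`. This splits the Cauchy–Pompeiu integrand into radial and angular
derivatives. -/
theorem dbar_div_exp_mul_I {g : ℂ → ℂ} (w : ℂ) (θ : ℝ) :
    dbar g w / exp (θ * I) =
      fderiv ℝ g w (exp (θ * I)) + I * fderiv ℝ g w (I * exp (θ * I)) := by
  have h1 : exp (θ * I) = (Real.cos θ) • (1 : ℂ) + (Real.sin θ) • I := by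
    rw [exp_mul_I]; simp
  have h2 : I * exp (θ * I) = (-Real.sin θ) • (1 : ℂ) + (Real.cos θ) • I := by
    rw [h1]
    simp only [real_smul, ofReal_neg]
    linear_combination (Real.sin θ : ℂ) * I_mul_I
  rw [div_eq_iff (exp_ne_zero _), h2, h1]
  simp only [map_add, map_smul, dbar]
  simp only [real_smul, ofReal_neg, mul_one]
  have h3 : (Real.cos θ : ℂ) ^ 2 + (Real.sin θ : ℂ) ^ 2 = 1 := by
    exact_mod_cast Real.cos_sq_add_sin_sq θ
  set c : ℂ := (Real.cos θ : ℂ)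
  set s : ℂ := (Real.sin θ : ℂ)
  set x := fderiv ℝ g w 1
  set y := fderiv ℝ g w I
  linear_combination (-(x + I * y)) * h3 + (x * s ^ 2 - y * c * s) * I_mul_I

theorem HasCompactSupport.exists_notMem_tsupport_of_lt_norm {g : ℂ → ℂ} (hg : HasCompactSupport g) :
    ∃ R > 0, ∀ w, R < ‖w‖ → w ∉ tsupport g := by
  obtain ⟨R, hR, h⟩ := hg.isCompact.isBounded.exists_pos_norm_le
  exact ⟨R, hR, fun w hw hm => absurd (h w hm) (not_le.mpr hw)⟩

theorem integrableOn_polarCoord_target {F : ℝ × ℝ → ℂ} (hF : Continuous F) {R : ℝ}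
    (hR : ∀ p : ℝ × ℝ, R < p.1 → F p = 0) : IntegrableOn F polarCoord.target := by
  have h1 : IntegrableOn F (Icc 0 R ×ˢ Icc (-Real.pi) Real.pi) :=
    hF.continuousOn.integrableOn_compact (isCompact_Icc.prod isCompact_Icc)
  refine h1.of_forall_sdiff_eq_zero polarCoord.open_target.measurableSet ?_
  rintro ⟨r, θ⟩ ⟨⟨hr, hθ⟩, h⟩
  refine hR _ (not_le.mp fun hrR => h ⟨⟨le_of_lt hr, hrR⟩, hθ.1.le, hθ.2.le⟩)

theorem hasDerivAt_ofReal_mul_exp (r θ : ℝ) :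
    HasDerivAt (fun r : ℝ => (r : ℂ) * exp (θ * I)) (exp (θ * I)) r := by
  simpa using (ofRealCLM.hasDerivAt (x := r)).mul_const (exp (θ * I))

theorem hasDerivAt_mul_exp_ofReal (r θ : ℝ) :
    HasDerivAt (fun θ : ℝ => (r : ℂ) * exp (θ * I)) (r * (I * exp (θ * I))) θ := by
  have h := ((((ofRealCLM.hasDerivAt (x := θ)).mul_const I).cexp).const_mul (r : ℂ))
  simpa [mul_comm] using h

theorem integral_radial {g : ℂ → ℂ} (hg : ContDiff ℝ 1 g) (hc : HasCompactSupport g) (θ : ℝ) :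
    ∫ r in Ioi (0 : ℝ), fderiv ℝ g (r * exp (θ * I)) (exp (θ * I)) = -g 0 := by
  have hd : ∀ r : ℝ, HasDerivAt (fun r : ℝ => g (r * exp (θ * I)))
      (fderiv ℝ g (r * exp (θ * I)) (exp (θ * I))) r := fun r =>
    ((hg.differentiable one_ne_zero _).hasFDerivAt).comp_hasDerivAt r
      (hasDerivAt_ofReal_mul_exp r θ)
  have hC : ContDiff ℝ 1 fun r : ℝ => g (r * exp (θ * I)) := by
    refine hg.comp ?_
    exact ofRealCLM.contDiff.mul contDiff_const
  have hs : HasCompactSupport fun r : ℝ => g (r * exp (θ * I)) := by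
    obtain ⟨R, -, hR⟩ := hc.exists_notMem_tsupport_of_lt_norm
    refine HasCompactSupport.intro (isCompact_Icc (a := -R) (b := R)) fun r hr => ?_
    refine image_eq_zero_of_notMem_tsupport (hR _ ?_)
    rw [norm_mul, norm_exp_ofReal_mul_I, mul_one, norm_real, Real.norm_eq_abs]
    by_contra! h
    exact hr (abs_le.mp h)
  have := HasCompactSupport.integral_Ioi_deriv_eq hC hs 0
  simp only [(hd _).deriv] at this
  simpa using this

/-- Up to the factor `r`, the integrand is the derivative of a `2π`-periodic function of the angle.
-/
theorem integral_angular {g : ℂ → ℂ} (hg : ContDiff ℝ 1 g) {r : ℝ} (hr : 0 < r) :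
    ∫ θ in Ioo (-Real.pi) Real.pi, fderiv ℝ g (r * exp (θ * I)) (I * exp (θ * I)) = 0 := by
  have hd : ∀ θ : ℝ, HasDerivAt (fun θ : ℝ => g (r * exp (θ * I)))
      (r * fderiv ℝ g (r * exp (θ * I)) (I * exp (θ * I))) θ := fun θ => by
    have h := ((hg.differentiable one_ne_zero _).hasFDerivAt).comp_hasDerivAt θ
      (hasDerivAt_mul_exp_ofReal r θ)
    rwa [← real_smul (x := r) (z := I * _), map_smul] at h
  have hcont : Continuous fun θ : ℝ =>
      (r : ℂ) * fderiv ℝ g (r * exp (θ * I)) (I * exp (θ * I)) := by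
    have := hg.continuous_fderiv one_ne_zero
    fun_prop
  have h := intervalIntegral.integral_eq_sub_of_hasDerivAt (fun θ _ => hd θ)
    (hcont.intervalIntegrable (-Real.pi) Real.pi)
  rw [intervalIntegral.integral_const_mul] at h
  have h2 : exp ((Real.pi : ℝ) * I) = exp ((-Real.pi : ℝ) * I) := by
    rw [ofReal_neg, neg_mul, exp_neg, exp_pi_mul_I]; norm_num
  rw [h2, sub_self, mul_eq_zero, intervalIntegral.integral_of_le (by linarith [Real.pi_pos]),
    integral_Ioc_eq_integral_Ioo] at h
  exact h.resolve_left (by exact_mod_cast hr.ne')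

/-- The **Cauchy–Pompeiu formula** at the origin for compactly supported functions. -/
theorem integral_dbar_div {g : ℂ → ℂ} (hg : ContDiff ℝ 1 g) (hc : HasCompactSupport g) :
    ∫ w, dbar g w / w = -(2 * Real.pi) * g 0 := by
  have hfc := hg.continuous_fderiv one_ne_zero
  obtain ⟨R, -, hR⟩ := hc.exists_notMem_tsupport_of_lt_norm
  have hz : ∀ (p : ℝ × ℝ), R < p.1 → fderiv ℝ g (p.1 * exp (p.2 * I)) = 0 := fun p hp => by
    refine image_eq_zero_of_notMem_tsupport fun h => hR _ ?_ (tsupport_fderiv_subset ℝ h)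
    rw [norm_mul, norm_exp_ofReal_mul_I, mul_one, norm_real]
    exact hp.trans_le (le_abs_self _)
  set A : ℝ × ℝ → ℂ := fun p => fderiv ℝ g (p.1 * exp (p.2 * I)) (exp (p.2 * I)) with hA
  set B : ℝ × ℝ → ℂ := fun p => fderiv ℝ g (p.1 * exp (p.2 * I)) (I * exp (p.2 * I)) with hB
  have hAi : IntegrableOn A polarCoord.target :=
    integrableOn_polarCoord_target (by fun_prop) (R := R) fun p hp => by simp [hA, hz p hp]
  have hBi : IntegrableOn B polarCoord.target :=
    integrableOn_polarCoord_target (by fun_prop) (R := R) fun p hp => by simp [hB, hz p hp]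
  have h1 : ∫ w, dbar g w / w = ∫ p in polarCoord.target, (A p + I * B p) := by
    rw [← Complex.integral_comp_polarCoord_symm]
    refine setIntegral_congr_fun polarCoord.open_target.measurableSet ?_
    rintro ⟨r, θ⟩ ⟨hr, -⟩
    have hr' : (r : ℂ) ≠ 0 := by exact_mod_cast (ne_of_gt hr)
    have he : Complex.polarCoord.symm (r, θ) = r * exp (θ * I) := by
      simp [exp_mul_I]
    simp only [hA, hB, he, ← dbar_div_exp_mul_I, real_smul]
    field_simp
  have hAv : ∫ p in polarCoord.target, A p = -(2 * Real.pi) * g 0 := by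
    rw [polarCoord_target] at hAi ⊢
    rw [Measure.volume_eq_prod] at hAi ⊢
    -- The radial variable is integrated first, so each ray contributes `-g 0`.
    rw [← setIntegral_prod_swap,
      setIntegral_prod _ (show IntegrableOn (fun z => A z.swap) _ _ from hAi.swap)]
    simp only [hA, Prod.fst_swap, Prod.snd_swap, integral_radial hg hc]
    simp [Real.pi_pos.le]
    left
    ring
  have hBv : ∫ p in polarCoord.target, B p = 0 := by
    rw [polarCoord_target] at hBi ⊢
    rw [Measure.volume_eq_prod] at hBi ⊢
    rw [setIntegral_prod _ hBi]
    exact setIntegral_eq_zero_of_forall_eq_zero fun r hr => integral_angular hg hr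
  rw [h1, integral_add hAi (hBi.const_mul I), integral_const_mul, hAv, hBv]
  simp

/-- The **Cauchy–Pompeiu formula** for compactly supported functions. -/
theorem integral_dbar_div_sub {g : ℂ → ℂ} (hg : ContDiff ℝ 1 g) (hc : HasCompactSupport g)
    (z : ℂ) : ∫ w, dbar g w / (w - z) = -(2 * Real.pi) * g z := by
  have h := integral_dbar_div (g := fun w => g (w + z)) (hg.comp (contDiff_id.add contDiff_const))
    (hc.comp_homeomorph (Homeomorph.addRight z))
  rw [zero_add] at h
  rw [← h, ← integral_add_right_eq_self _ z]
  simp [dbar, fderiv_comp_add_right]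

/-- If `h` is holomorphic near the support of the derivative of `φ`, then `∂φ/∂z̄` is orthogonal
to the derivative of `h`. -/
theorem integral_dbar_mul_deriv_eq_zero {φ h : ℂ → ℂ} (hφ : ContDiff ℝ 2 φ)
    (hc : HasCompactSupport φ) {W : Set ℂ} (hW : IsOpen W) (hh : DifferentiableOn ℂ h W)
    (hφW : tsupport (fderiv ℝ φ) ⊆ W) : ∫ w, dbar φ w * deriv h w = 0 := by
  have hφ' : ContDiff ℝ 1 (fderiv ℝ φ) := hφ.fderiv_right (by norm_num)
  have hsub : ∀ v, tsupport (fun w => fderiv ℝ φ w v) ⊆ tsupport (fderiv ℝ φ) := fun v =>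
    closure_mono fun w hw hz => hw (by simp [show fderiv ℝ φ w = 0 from hz])
  have hcv : ∀ v, HasCompactSupport fun w => fderiv ℝ φ w v := fun v =>
    (hc.fderiv ℝ).mono' (subset_closure.trans (hsub v))
  have hdv : ∀ v, ContDiff ℝ 1 fun w => fderiv ℝ φ w v := fun v => hφ'.clm_apply contDiff_const
  -- Values of `f` outside `W` are arbitrary; the factor `u`, supported in `W`, removes them.
  have hint : ∀ {f u : ℂ → ℂ}, ContinuousOn f W → Continuous u → HasCompactSupport u →
      tsupport u ⊆ tsupport (fderiv ℝ φ) → Integrable fun w => f w * u w := by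
    intro f u hf hu huc hus
    refine Continuous.integrable_of_hasCompactSupport (continuous_of_tsupport fun w hw => ?_)
      (huc.mul_left)
    have hw' : W ∈ 𝓝 w := hW.mem_nhds
      (hφW (hus (closure_mono (Function.support_mul_subset_right f u) hw)))
    exact (hf.continuousAt hw').mul hu.continuousAt
  have hhr : ∀ w ∈ W, HasFDerivAt h ((fderiv ℂ h w).restrictScalars ℝ) w := fun w hw =>
    (hh.differentiableAt (hW.mem_nhds hw)).hasFDerivAt.restrictScalars ℝ
  have hdc : ContinuousOn (deriv h) W := (hh.deriv hW).continuousOn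
  have hfd : ∀ v v' w, fderiv ℝ h w v * fderiv ℝ φ w v' = (v * deriv h w) * fderiv ℝ φ w v' := by
    intro v v' w
    by_cases hw : w ∈ tsupport (fderiv ℝ φ)
    · rw [(hhr w (hφW hw)).fderiv, ContinuousLinearMap.coe_restrictScalars',
        fderiv_eq_smul_deriv, smul_eq_mul]
    · simp [image_eq_zero_of_notMem_tsupport hw]
  have hi1 : ∀ v v', Integrable fun w => (v * deriv h w) * fderiv ℝ φ w v' := fun v v' =>
    hint (continuousOn_const.mul hdc) (hdv v').continuous (hcv v') (hsub v')
  have hsub2 : ∀ v v', tsupport (fun w => fderiv ℝ (fun w => fderiv ℝ φ w v') w v) ⊆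
      tsupport (fderiv ℝ φ) := fun v v' =>
    (tsupport_fderiv_apply_subset ℝ v).trans (hsub v')
  have hi2 : ∀ v v', Integrable fun w => h w * fderiv ℝ (fun w => fderiv ℝ φ w v') w v :=
    fun v v' => hint hh.continuousOn
      (((hdv v').continuous_fderiv one_ne_zero).clm_apply continuous_const)
      ((hc.fderiv ℝ).mono' (subset_closure.trans (hsub2 v v'))) (hsub2 v v')
  have key : ∀ v v', ∫ w, h w * fderiv ℝ (fun w => fderiv ℝ φ w v') w v =
      -∫ w, (v * deriv h w) * fderiv ℝ φ w v' := fun v v' => by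
    rw [integral_mul_fderiv_eq_neg_fderiv_mul_of_integrable (by simpa only [hfd] using hi1 v v')
      (hi2 v v') (hint hh.continuousOn (hdv v').continuous (hcv v') (hsub v'))
      (fun w hw => (hhr w (hφW (hsub v' hw))).differentiableAt)
      (fun w _ => (hdv v').differentiable one_ne_zero w)]
    simp only [hfd]
  -- Symmetry of the second derivative equates the two integrations by parts of `h` against the
  -- mixed derivative of `φ`; the difference of the results is `I` times the wanted integral.
  have hsymm : ∀ w, fderiv ℝ (fun w => fderiv ℝ φ w 1) w I =
      fderiv ℝ (fun w => fderiv ℝ φ w I) w 1 := fun w => by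
    have hd := hφ'.differentiable one_ne_zero w
    rw [fderiv_clm_apply hd (differentiableAt_const _),
      fderiv_clm_apply hd (differentiableAt_const _)]
    simpa using (hφ.contDiffAt.isSymmSndFDerivAt (by simp)) I 1
  have h1 := key I 1
  have h2 := key 1 I
  simp only [hsymm] at h1
  rw [h1, neg_inj] at h2
  have h3 : ∀ w, I * (dbar φ w * deriv h w) =
      (I * deriv h w) * fderiv ℝ φ w 1 - (1 * deriv h w) * fderiv ℝ φ w I := fun w => by
    rw [dbar]
    linear_combination (fderiv ℝ φ w I * deriv h w) * I_mul_I
  have h4 : I * ∫ w, dbar φ w * deriv h w = 0 := by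
    rw [← integral_const_mul]
    simp only [h3]
    rw [integral_sub (hi1 I 1) (hi1 1 I), h2, sub_self]
  exact (mul_eq_zero.mp h4).resolve_left I_ne_zero

/-- A smooth cutoff function: it equals `1` near the compact set `C` and has compact support in the
open set `V`. -/
theorem exists_contDiff_cutoff {C V : Set ℂ} (hC : IsCompact C) (hV : IsOpen V) (h : C ⊆ V) :
    ∃ φ : ℂ → ℂ, ContDiff ℝ 2 φ ∧ HasCompactSupport φ ∧ tsupport φ ⊆ V ∧
      ∀ᶠ w in 𝓝ˢ C, φ w = 1 := by
  obtain ⟨L, hL, hLc, hCL, hLV⟩ := exists_compact_closed_between hC hV h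
  obtain ⟨f, h1, h0, -⟩ := exists_contMDiffMap_one_nhds_of_subset_interior
    (modelWithCornersSelf ℝ ℂ) (n := 2) hC.isClosed hCL
  have hs : Function.support (fun w => (f w : ℂ)) ⊆ L := fun w hw => by
    by_contra hwL
    exact hw (by simp [h0 w hwL])
  refine ⟨fun w => (f w : ℂ), ofRealCLM.contDiff.comp f.contMDiff.contDiff, hL.of_isClosed_subset
    isClosed_closure (closure_minimal hs hLc), (closure_minimal hs hLc).trans hLV, ?_⟩
  filter_upwards [h1] with w hw
  simp [hw]

/-! ### The algebra `P(K)` and polynomial convexity -/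

/-- The Banach algebra `P(K)` of uniform limits of polynomials on the compact set `K`. -/
abbrev polynomialClosure (K : Set ℂ) [CompactSpace K] : Subalgebra ℂ C(K, ℂ) :=
  (polynomialFunctions K).topologicalClosure

instance (K : Set ℂ) [CompactSpace K] : CompleteSpace (polynomialClosure K) :=
  (Subalgebra.isClosed_topologicalClosure (polynomialFunctions K)).completeSpace_coe

/-- The coordinate function `z` as an element of `P(K)`. -/
def polynomialCoord (K : Set ℂ) [CompactSpace K] : polynomialClosure K :=
  ⟨Polynomial.X.toContinuousMapOn K, Subalgebra.le_topologicalClosure _ ⟨Polynomial.X, by simp⟩⟩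

/-- Evaluation at a point of `K` as a continuous functional on `P(K)`. -/
def polynomialEval (K : Set ℂ) [CompactSpace K] (z : K) : polynomialClosure K →L[ℂ] ℂ where
  toLinearMap := (ContinuousMap.evalCLM ℂ z).toLinearMap ∘ₗ (polynomialClosure K).val.toLinearMap
  cont := (ContinuousMap.evalCLM ℂ z).continuous.comp continuous_subtype_val

theorem polynomialEval_apply (K : Set ℂ) [CompactSpace K] (z : K) (f : polynomialClosure K) :
    polynomialEval K z f = (f : C(K, ℂ)) z := rfl

/-- Evaluation is multiplicative, so off the spectrum the Cauchy kernel is the value of an element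
of `P(K)`. -/
theorem polynomialEval_resolvent {K : Set ℂ} [CompactSpace K] {w : ℂ}
    (hw : w ∉ spectrum ℂ (polynomialCoord K)) (z : K) :
    polynomialEval K z (resolvent (polynomialCoord K) w) = 1 / (w - z) := by
  rw [spectrum.notMem_iff] at hw
  have h := congrArg (polynomialEval K z) (Ring.mul_inverse_cancel _ hw)
  have h' : (w - z) * polynomialEval K z (resolvent (polynomialCoord K) w) = 1 := by
    simpa [polynomialEval_apply, polynomialCoord, resolvent, algebraMap_apply] using h
  exact eq_one_div_of_mul_eq_one_right h'

theorem spectrum_polynomialCoord (K : Set ℂ) [CompactSpace K] :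
    spectrum ℂ (polynomialCoord K : C(K, ℂ)) = K := by
  rw [ContinuousMap.spectrum_eq_range]
  ext z
  simp [polynomialCoord]

theorem subset_spectrum_polynomialCoord (K : Set ℂ) [CompactSpace K] :
    K ⊆ spectrum ℂ (polynomialCoord K) := by
  conv_lhs => rw [← spectrum_polynomialCoord K]
  exact spectrum.subset_subalgebra _

/-- Passing to a closed subalgebra only fills holes: the frontier of the spectrum in `P(K)` lies in
the spectrum in `C(K, ℂ)`, which is `K`. -/
theorem isOpen_spectrum_polynomialCoord_diff (K : Set ℂ) [CompactSpace K] :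
    IsOpen (spectrum ℂ (polynomialCoord K) \ K) := by
  have hK : IsClosed K := (isCompact_iff_compactSpace.mpr ‹_›).isClosed
  have := (Subalgebra.isClosed_topologicalClosure (polynomialFunctions K))
  have hf : frontier (spectrum ℂ (polynomialCoord K)) ⊆ K := by
    have h := Subalgebra.frontier_spectrum (polynomialClosure K) (polynomialCoord K)
    rwa [spectrum_polynomialCoord] at h
  have h : spectrum ℂ (polynomialCoord K) \ K = interior (spectrum ℂ (polynomialCoord K)) \ K := by
    ext z
    refine ⟨fun hz => ⟨?_, hz.2⟩, fun hz => ⟨interior_subset hz.1, hz.2⟩⟩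
    by_contra hi
    exact hz.2 (hf ⟨subset_closure hz.1, hi⟩)
  rw [h]
  exact isOpen_interior.sdiff hK

/-- The primitive is a continuous logarithm of `z - a`, differentiable as a local inverse of `exp w
+ a`. -/
theorem exists_hasDerivAt_inv_sub {Ω : Set ℂ} (hΩ : IsSimplyConnected Ω) (hΩo : IsOpen Ω) {a : ℂ}
    (ha : a ∉ Ω) : ∃ h : ℂ → ℂ, ∀ z ∈ Ω, HasDerivAt h (z - a)⁻¹ z := by
  obtain ⟨h, hc, he⟩ := exists_continuousOn_eqOn_exp_comp hΩ hΩo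
    (g := fun z => z - a) (by fun_prop) (by
      rintro ⟨z, hz, hz0⟩
      exact ha (sub_eq_zero.mp hz0 ▸ hz))
  refine ⟨h, fun z hz => ?_⟩
  have hez : exp (h z) = z - a := he hz
  rw [← hez]
  refine HasDerivAt.of_local_left_inverse (f := fun w => exp w + a)
    (hc.continuousAt (hΩo.mem_nhds hz)) ((hasDerivAt_exp _).add_const a) (exp_ne_zero _) ?_
  filter_upwards [hΩo.mem_nhds hz] with y hy
  have : exp (h y) = y - a := he hy
  rw [this, sub_add_cancel]

theorem notMem_tsupport_fderiv_of_eventuallyEq {φ : ℂ → ℂ} {w : ℂ}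
    (h : ∀ᶠ x in 𝓝 w, φ x = 1) : w ∉ tsupport (fderiv ℝ φ) := by
  rw [notMem_tsupport_iff_eventuallyEq]
  filter_upwards [h.eventually_nhds] with x hx
  have : φ =ᶠ[𝓝 x] fun _ => 1 := hx
  rw [this.fderiv_eq]
  simp

/-- Simply connected open sets are polynomially convex: the spectrum of the coordinate function in
`P(K)`, which is the polynomial hull of `K`, does not leave `Ω`. -/
theorem spectrum_polynomialCoord_subset {Ω : Set ℂ} (hΩ : IsSimplyConnected Ω) (hΩo : IsOpen Ω)
    {K : Set ℂ} [CompactSpace K] (hK : K ⊆ Ω) : spectrum ℂ (polynomialCoord K) ⊆ Ω := by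
  intro a ha
  by_contra haΩ
  set σ := spectrum ℂ (polynomialCoord K) with hσ
  have hE : IsCompact (σ \ Ω) := (spectrum.isCompact _).diff hΩo
  obtain ⟨φ, hφ, hφc, hφV, hφ1⟩ := exists_contDiff_cutoff hE
    (isOpen_spectrum_polynomialCoord_diff K) (sdiff_subset_sdiff_right hK)
  have hsupp : tsupport (fderiv ℝ φ) ⊆ Ω := fun w hw => by
    by_contra hwΩ
    have hwσ : w ∈ σ := (hφV (tsupport_fderiv_subset ℝ hw)).1
    exact notMem_tsupport_fderiv_of_eventuallyEq
      (hφ1.filter_mono (nhds_le_nhdsSet (show w ∈ σ \ Ω from ⟨hwσ, hwΩ⟩))) hw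
  obtain ⟨h, hh⟩ := exists_hasDerivAt_inv_sub hΩ hΩo haΩ
  have h0 := integral_dbar_mul_deriv_eq_zero hφ hφc hΩo
    (fun z hz => (hh z hz).differentiableAt.differentiableWithinAt) hsupp
  have h1 := integral_dbar_div_sub (hφ.of_le (by norm_num)) hφc a
  have h2 : ∀ w, dbar φ w * deriv h w = dbar φ w / (w - a) := fun w => by
    by_cases hw : w ∈ tsupport (fderiv ℝ φ)
    · rw [(hh w (hsupp hw)).deriv, div_eq_mul_inv]
    · simp [dbar_eq_zero_of_fderiv_eq_zero (image_eq_zero_of_notMem_tsupport hw)]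
  simp only [h2] at h0
  rw [h0, (hφ1.self_of_nhdsSet a ⟨ha, haΩ⟩)] at h1
  simp [Real.pi_ne_zero] at h1

/-! ### Runge's theorem -/

/-- **Runge's theorem** for simply connected open sets. -/
theorem exists_polynomial_norm_sub_lt {Ω : Set ℂ} (hΩ : IsSimplyConnected Ω) (hΩo : IsOpen Ω)
    {K : Set ℂ} (hKc : IsCompact K) (hK : K ⊆ Ω) {f : ℂ → ℂ} (hf : DifferentiableOn ℂ f Ω)
    {ε : ℝ} (hε : 0 < ε) : ∃ p : Polynomial ℂ, ∀ z ∈ K, ‖f z - p.eval z‖ < ε := by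
  have : CompactSpace K := isCompact_iff_compactSpace.mp hKc
  set x := polynomialCoord K
  have hσΩ := spectrum_polynomialCoord_subset hΩ hΩo hK
  obtain ⟨φ, hφ, hφc, hφΩ, hφ1⟩ := exists_contDiff_cutoff (spectrum.isCompact x) hΩo hσΩ
  have hsupp : tsupport (dbar φ) ⊆ Ω \ spectrum ℂ x := fun w hw =>
    ⟨hφΩ (tsupport_fderiv_subset ℝ (tsupport_dbar_subset φ hw)), fun hwσ =>
      notMem_tsupport_fderiv_of_eventuallyEq (hφ1.filter_mono (nhds_le_nhdsSet hwσ))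
        (tsupport_dbar_subset φ hw)⟩
  -- The Cauchy–Pompeiu integrand for `φ * f` with the resolvent as kernel. It is continuous because
  -- `dbar φ` is supported in `Ω` and off the spectrum.
  set F : ℂ → polynomialClosure K := fun w => (dbar φ w * f w) • resolvent x w with hF
  have hFs : Function.support F ⊆ tsupport (dbar φ) := fun w hw => by
    by_contra hw'
    exact hw (by simp [hF, image_eq_zero_of_notMem_tsupport hw'])
  have hFc : Continuous F := continuous_of_tsupport fun w hw => by
    have hw' := hsupp (closure_minimal hFs (isClosed_tsupport _) hw)
    exact (((continuous_dbar (hφ.of_le (by norm_num))).continuousAt).mul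
      (hf.differentiableAt (hΩo.mem_nhds hw'.1)).continuousAt).smul
      (spectrum.hasDerivAt_resolvent_const_left (notMem_compl_iff.mp hw'.2)).continuousAt
  have hFi : Integrable F := hFc.integrable_of_hasCompactSupport
    ((hφc.fderiv ℝ).of_isClosed_subset (isClosed_tsupport _)
      ((closure_minimal hFs (isClosed_tsupport _)).trans (tsupport_dbar_subset φ)))
  have hφf : ContDiff ℝ 1 (φ * f) := contDiff_of_tsupport fun w hw => by
    have hwΩ : w ∈ Ω := hφΩ (tsupport_mul_subset_left hw)
    exact (hφ.of_le (by norm_num)).contDiffAt.mul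
      (((hf.contDiffOn hΩo).contDiffAt (hΩo.mem_nhds hwΩ)).restrict_scalars ℝ)
  have heval : ∀ z : K, polynomialEval K z (∫ w, F w) = -(2 * Real.pi) * f z := fun z => by
    have hz : φ z = 1 := hφ1.self_of_nhdsSet z (subset_spectrum_polynomialCoord K z.2)
    have h := integral_dbar_div_sub hφf hφc.mul_right z
    rw [Pi.mul_apply, hz, one_mul] at h
    rw [← h, ← ContinuousLinearMap.integral_comp_comm _ hFi]
    congr 1
    ext w
    rw [hF, map_smul, smul_eq_mul]
    -- Off this support both integrands vanish: on `tsupport φ`, `f` is holomorphic and the product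
    -- rule applies; elsewhere `φ * f` is locally zero.
    by_cases hw : w ∈ tsupport (dbar φ)
    · rw [polynomialEval_resolvent (hsupp hw).2, dbar_mul_of_differentiableAt
        (hφ.differentiable (by norm_num) w) (hf.differentiableAt (hΩo.mem_nhds (hsupp hw).1))]
      ring
    · rw [image_eq_zero_of_notMem_tsupport hw]
      by_cases hwφ : w ∈ tsupport φ
      · rw [dbar_mul_of_differentiableAt (hφ.differentiable (by norm_num) w)
          (hf.differentiableAt (hΩo.mem_nhds (hφΩ hwφ))), image_eq_zero_of_notMem_tsupport hw]
        simp
      · have hwf : w ∉ tsupport (fderiv ℝ (φ * f)) := fun hm =>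
          hwφ (tsupport_mul_subset_left (tsupport_fderiv_subset ℝ hm))
        simp [dbar_eq_zero_of_fderiv_eq_zero (image_eq_zero_of_notMem_tsupport hwf)]
  set y : polynomialClosure K := (-(2 * Real.pi) : ℂ)⁻¹ • ∫ w, F w
  have hy : ∀ z : K, (y : C(K, ℂ)) z = f z := fun z => by
    rw [← polynomialEval_apply, map_smul, heval, smul_eq_mul, inv_mul_cancel_left₀]
    simp [Real.pi_ne_zero]
  obtain ⟨q, ⟨p, -, rfl⟩, hp⟩ := Metric.mem_closure_iff.mp y.2 ε hε
  refine ⟨p, fun z hz => ?_⟩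
  have := (ContinuousMap.dist_lt_iff hε).mp hp ⟨z, hz⟩
  rw [hy, dist_eq_norm] at this
  simpa using this

/-! ### The space `H(Ω)` and continuity of the Taylor sums -/

variable {Ω : Opens ℂ}

instance (Ω : Opens ℂ) : LocallyCompactSpace Ω := Ω.isOpen.locallyCompactSpace

theorem eqOn_extendZero_restrict (f : ℂ → ℂ) : EqOn (extendZero fun ζ : Ω => f ζ) f Ω :=
  fun ζ hζ => extendZero_apply (fun ζ : Ω => f ζ) ⟨ζ, hζ⟩

/-- The restriction to `Ω` of a function holomorphic on `Ω`, as an element of `H(Ω)`. -/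
def HolSpace.ofDifferentiableOn {f : ℂ → ℂ} (hf : DifferentiableOn ℂ f Ω) : HolSpace Ω :=
  ⟨⟨fun ζ => f ζ, hf.continuousOn.domRestrict⟩, hf.congr (eqOn_extendZero_restrict f)⟩

theorem tendstoLocallyUniformlyOn_extendZero_iff {ι : Type*} {F : ι → Ω → ℂ} {f : Ω → ℂ}
    {l : Filter ι} : TendstoLocallyUniformlyOn (fun i => extendZero (F i)) (extendZero f) l Ω ↔
      TendstoLocallyUniformly F f l := by
  rw [tendstoLocallyUniformlyOn_iff_tendstoLocallyUniformly_comp_coe]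
  have h : ∀ g : Ω → ℂ, (extendZero g ∘ (↑) : Ω → ℂ) = g := fun g => funext (extendZero_apply g)
  change TendstoLocallyUniformly (fun i => (extendZero (F i) ∘ (↑) : Ω → ℂ))
    (extendZero f ∘ (↑) : Ω → ℂ) l ↔ _
  simp only [h]

theorem isClosed_holomorphic (Ω : Opens ℂ) :
    IsClosed {f : C(Ω, ℂ) | DifferentiableOn ℂ (extendZero f) Ω} := by
  rw [isClosed_iff_clusterPt]
  intro f hf
  have : (𝓝 f ⊓ 𝓟 {f : C(Ω, ℂ) | DifferentiableOn ℂ (extendZero f) Ω}).NeBot := hf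
  have h : TendstoLocallyUniformly (fun (g : C(Ω, ℂ)) => ⇑g) f
      (𝓝 f ⊓ 𝓟 {f : C(Ω, ℂ) | DifferentiableOn ℂ (extendZero f) Ω}) :=
    ContinuousMap.tendsto_iff_tendstoLocallyUniformly.mp (tendsto_id.mono_left inf_le_left)
  exact (tendstoLocallyUniformlyOn_extendZero_iff.mpr h).differentiableOn
    (eventually_inf_principal.mpr (Eventually.of_forall fun g hg => hg)) Ω.isOpen

instance (Ω : Opens ℂ) : BaireSpace (HolSpace Ω) := by
  -- A complete space with countably generated uniformity is Baire; completeness comes from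
  -- closedness in `C(Ω, ℂ)`.
  have : CompleteSpace (HolSpace Ω) := (isClosed_holomorphic Ω).completeSpace_coe
  have : (uniformity C(Ω, ℂ)).IsCountablyGenerated := inferInstance
  have : (uniformity (HolSpace Ω)).IsCountablyGenerated := Filter.comap.isCountablyGenerated _ _
  infer_instance

theorem differentiableOn_iteratedDeriv {f : ℂ → ℂ} {U : Set ℂ} (hU : IsOpen U)
    (hf : DifferentiableOn ℂ f U) (n : ℕ) : DifferentiableOn ℂ (iteratedDeriv n f) U := by
  induction n with
  | zero => simpa using hf
  | succ n ih => rw [iteratedDeriv_succ]; exact ih.deriv hU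

/-- Weierstrass's theorem on derivatives, iterated. -/
theorem TendstoLocallyUniformlyOn.iteratedDeriv {ι : Type*} {F : ι → ℂ → ℂ} {f : ℂ → ℂ}
    {l : Filter ι} {U : Set ℂ} (h : TendstoLocallyUniformlyOn F f l U) (hU : IsOpen U)
    (hF : ∀ᶠ i in l, DifferentiableOn ℂ (F i) U) (n : ℕ) :
    TendstoLocallyUniformlyOn (fun i => iteratedDeriv n (F i)) (iteratedDeriv n f) l U := by
  induction n with
  | zero => simpa using h
  | succ n ih =>
    simp only [iteratedDeriv_succ]
    exact ih.deriv (hF.mono fun i hi => differentiableOn_iteratedDeriv hU hi n) hU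

/-- The `n`-th derivative as a map from `H(Ω)` to `C(Ω, ℂ)`. -/
def HolSpace.iteratedDeriv (n : ℕ) (f : HolSpace Ω) : C(Ω, ℂ) :=
  ⟨fun ζ => _root_.iteratedDeriv n (extendZero f.1) ζ,
    (differentiableOn_iteratedDeriv Ω.isOpen f.2 n).continuousOn.domRestrict⟩

theorem HolSpace.continuous_iteratedDeriv (n : ℕ) :
    Continuous (HolSpace.iteratedDeriv n : HolSpace Ω → C(Ω, ℂ)) := by
  refine continuous_iff_continuousAt.mpr fun f => ?_
  refine ContinuousMap.tendsto_iff_tendstoLocallyUniformly.mpr ?_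
  have h : TendstoLocallyUniformly (fun (g : HolSpace Ω) => ⇑g.1) f.1 (𝓝 f) :=
    ContinuousMap.tendsto_iff_tendstoLocallyUniformly.mp continuous_subtype_val.continuousAt
  have h2 := (tendstoLocallyUniformlyOn_extendZero_iff.mpr h).iteratedDeriv Ω.isOpen
    (Eventually.of_forall fun g => g.2) n
  exact tendstoLocallyUniformlyOn_iff_tendstoLocallyUniformly_comp_coe.mp h2

/-- `T̃_N` as a map from `H(Ω)` to `C(Ω, ℂ)`. -/
def centerSumMap (N : ℕ) (f : HolSpace Ω) : C(Ω, ℂ) :=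
  ∑ n ∈ Finset.range (N + 1), f.iteratedDeriv n *
    ⟨fun ζ => (n.factorial : ℂ)⁻¹ * (-(ζ : ℂ)) ^ n, by fun_prop⟩

theorem centerSumMap_apply (N : ℕ) (f : HolSpace Ω) (ζ : Ω) :
    centerSumMap N f ζ = centerSum N f ζ := by
  simp only [centerSumMap, centerSum, div_eq_mul_inv, mul_assoc, ContinuousMap.sum_apply,
    ContinuousMap.mul_apply]
  rfl

theorem continuous_centerSumMap (N : ℕ) :
    Continuous (centerSumMap N : HolSpace Ω → C(Ω, ℂ)) :=
  continuous_finsetSum _ fun n _ => (HolSpace.continuous_iteratedDeriv n).mul continuous_const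

/-- The functions `f ∈ H(Ω)` some `T̃_N(f)` of which is `ε`-close to `c` on `L`. -/
def centerApprox (L : Set Ω) (c : ℂ) (ε : ℝ) : Set (HolSpace Ω) :=
  {f | ∃ N, ∀ ζ ∈ L, centerSum N f ζ ∈ Metric.ball c ε}

theorem isOpen_centerApprox {L : Set Ω} (hL : IsCompact L) (c : ℂ) (ε : ℝ) :
    IsOpen (centerApprox L c ε) := by
  have : centerApprox L c ε =
      ⋃ N, centerSumMap N ⁻¹' {g : C(Ω, ℂ) | MapsTo g L (Metric.ball c ε)} := by
    ext f
    simp [centerApprox, MapsTo, centerSumMap_apply]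
  rw [this]
  exact isOpen_iUnion fun N =>
    (ContinuousMap.isOpen_setOfPred_mapsTo hL Metric.isOpen_ball).preimage (continuous_centerSumMap N)

/-! ### Polynomials and density -/

theorem Polynomial.iteratedDeriv_eval (p : Polynomial ℂ) (n : ℕ) :
    iteratedDeriv n (fun x => p.eval x) = fun x => (Polynomial.derivative^[n] p).eval x := by
  induction n with
  | zero => simp
  | succ n ih =>
    ext x
    rw [iteratedDeriv_succ, ih, Polynomial.deriv, Function.iterate_succ_apply']

theorem Polynomial.sum_iteratedDeriv_div_factorial (p : Polynomial ℂ) (z w : ℂ) :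
    ∑ n ∈ Finset.range (p.natDegree + 1),
      iteratedDeriv n (fun x => p.eval x) z / (n.factorial : ℂ) * (w - z) ^ n = p.eval w := by
  rw [← p.taylor_eval_sub z w, Polynomial.eval_eq_sum_range, Polynomial.natDegree_taylor]
  refine Finset.sum_congr rfl fun n _ => ?_
  rw [Polynomial.taylor_coeff, p.iteratedDeriv_eval,
    ← Polynomial.factorial_smul_hasseDeriv]
  have : (n.factorial : ℂ) ≠ 0 := Nat.cast_ne_zero.mpr n.factorial_ne_zero
  simp [this]

theorem centerSum_polynomial (p : Polynomial ℂ) (ζ : Ω) :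
    centerSum p.natDegree (HolSpace.ofDifferentiableOn (Ω := Ω) p.differentiable.differentiableOn) ζ
      = p.eval 0 := by
  rw [← p.sum_iteratedDeriv_div_factorial ζ 0, centerSum]
  refine Finset.sum_congr rfl fun n _ => ?_
  have : extendZero (HolSpace.ofDifferentiableOn (Ω := Ω)
      p.differentiable.differentiableOn).1 =ᶠ[𝓝 (ζ : ℂ)] fun x => p.eval x := by
    filter_upwards [Ω.isOpen.mem_nhds ζ.2] with x hx
    exact eqOn_extendZero_restrict (fun x => p.eval x) hx
  rw [this.iteratedDeriv_eq, zero_sub]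

/-- Polynomial approximation in `H(Ω)` with a prescribed value at the origin. -/
theorem exists_polynomial_eval_zero_eq (hΩ : IsSimplyConnected (Ω : Set ℂ)) (h0 : (0 : ℂ) ∉ Ω)
    {K : Set ℂ} (hKc : IsCompact K) (hK : K ⊆ Ω) {f : ℂ → ℂ} (hf : DifferentiableOn ℂ f Ω)
    (c : ℂ) {ε : ℝ} (hε : 0 < ε) :
    ∃ p : Polynomial ℂ, p.eval 0 = c ∧ ∀ z ∈ K, ‖f z - p.eval z‖ < ε := by
  have hz : ∀ z ∈ (Ω : Set ℂ), z ≠ 0 := fun z hz h => h0 (h ▸ hz)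
  obtain ⟨R, hR0, hR⟩ := hKc.isBounded.exists_pos_norm_le
  obtain ⟨q, hq⟩ := exists_polynomial_norm_sub_lt hΩ Ω.isOpen hKc hK
    (f := fun z => (f z - c) / z)
    (fun z hz' => ((hf z hz').sub_const c).div differentiableWithinAt_id (hz z hz'))
    -- Multiplication by `z` costs at most the factor `R`, which bounds `‖z‖` on `K`.
    (div_pos hε hR0)
  refine ⟨Polynomial.C c + Polynomial.X * q, by simp, fun z hzK => ?_⟩
  have hz0 := hz z (hK hzK)
  have : f z - (Polynomial.C c + Polynomial.X * q).eval z = z * ((f z - c) / z - q.eval z) := by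
    simp only [Polynomial.eval_add, Polynomial.eval_C, Polynomial.eval_mul, Polynomial.eval_X]
    field_simp
    ring
  rw [this, norm_mul]
  calc ‖z‖ * ‖(f z - c) / z - q.eval z‖ < ‖z‖ * (ε / R) :=
        mul_lt_mul_of_pos_left (hq z hzK) (norm_pos_iff.mpr hz0)
    _ ≤ R * (ε / R) := by gcongr; exact hR z hzK
    _ = ε := by field_simp

/-- The approximating polynomial has a Taylor sum equal to `c` at 0 for every centre, so `L` and `ε`
impose no further condition. -/
theorem dense_centerApprox (hΩ : IsSimplyConnected (Ω : Set ℂ)) (h0 : (0 : ℂ) ∉ Ω)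
    (L : Set Ω) (c : ℂ) {ε : ℝ} (hε : 0 < ε) : Dense (centerApprox L c ε) := by
  intro f
  have hb := (nhds_basis_uniformity'
    (Metric.uniformity_basis_dist (α := ℂ)).compactConvergenceUniformity (x := f.1)).comap
    (Subtype.val : HolSpace Ω → C(Ω, ℂ))
  rw [← nhds_subtype_eq_comap] at hb
  refine (mem_closure_iff_nhds_basis hb).mpr ?_
  rintro ⟨K, δ⟩ ⟨hK, hδ⟩
  obtain ⟨p, hp0, hp⟩ := exists_polynomial_eval_zero_eq hΩ h0
    (hK.image continuous_subtype_val) (Subtype.coe_image_subset _ K) f.2 c hδ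
  refine ⟨HolSpace.ofDifferentiableOn p.differentiable.differentiableOn, ⟨p.natDegree,
    fun ζ _ => ?_⟩, fun ζ hζ => ?_⟩
  · rw [centerSum_polynomial, hp0]
    exact Metric.mem_ball_self hε
  · have := hp ζ (mem_image_of_mem _ hζ)
    rwa [extendZero_apply, ← dist_eq_norm] at this

end

end

/-! ### The main theorem -/

open MeasureTheory Complex Set in
theorem mainTheorem2 (Ω : Opens ℂ) (hΩ : IsSimplyConnected (Ω : Set ℂ)) (h0 : (0 : ℂ) ∉ Ω) :
    (∃ G : Set (HolSpace Ω), IsGδ G ∧ Dense G ∧ G ⊆ constUniversal Ω) ∧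
      universalTaylor Ω ⊆ constUniversal Ω := by
  constructor
  · let E : CompactExhaustion Ω := default
    let A : ℕ × ℕ → Set (HolSpace Ω) := fun i =>
      centerApprox (E i.1) (denseSeq ℂ i.2) (1 / (i.1 + 1 : ℝ))
    have hA : ∀ i, IsOpen (A i) := fun i => isOpen_centerApprox (E.isCompact i.1) _ _
    refine ⟨⋂ i, A i, IsGδ.iInter_of_isOpen hA, dense_iInter_of_isOpen hA fun i =>
      dense_centerApprox hΩ h0 _ _ Nat.one_div_pos_of_nat, fun f hf c => ?_⟩
    -- The factor 2 pays for two errors: from `c` to a dense-sequence point, and from that point to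
    -- the Taylor sum.
    have hN : ∀ m : ℕ, ∃ N, ∀ ζ ∈ E m, dist c (centerSum N f ζ) < 2 * (1 / (m + 1 : ℝ)) := by
      intro m
      obtain ⟨j, hj⟩ := (denseRange_denseSeq ℂ).exists_dist_lt c
        (Nat.one_div_pos_of_nat (α := ℝ) (n := m))
      obtain ⟨N, hN⟩ := mem_iInter.mp hf (m, j)
      refine ⟨N, fun ζ hζ => (dist_triangle_right _ _ (denseSeq ℂ j)).trans_lt ?_⟩
      rw [two_mul]
      exact add_lt_add hj (hN ζ hζ)
    choose l hl using hN
    refine ⟨l, fun L hL => Metric.tendstoUniformlyOn_iff.mpr fun ε hε => ?_⟩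
    -- The indices `l` are chosen before `L`; every compact `L` lies in `E n` for all large `n`.
    obtain ⟨m, hm⟩ := E.exists_superset_of_isCompact hL
    have ht : Tendsto (fun n : ℕ => 2 * (1 / (n + 1 : ℝ))) atTop (𝓝 0) := by
      simpa using tendsto_one_div_add_atTop_nhds_zero_nat.const_mul (2 : ℝ)
    filter_upwards [eventually_ge_atTop m, ht.eventually_lt_const hε] with n hn hnε ζ hζ
    exact (hl n ζ (E.subset hn (hm hζ))).trans hnε
  · intro f hf c
    obtain ⟨l, hl⟩ := hf {0} isCompact_singleton (by simpa using h0)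
      (isConnected_compl_singleton_of_one_lt_rank (by simp) 0) (fun _ => c)
      continuousOn_const (differentiableOn_const c)
    refine ⟨l, fun L hL => Metric.tendstoUniformlyOn_iff.mpr fun ε hε => ?_⟩
    filter_upwards [Metric.tendstoUniformlyOn_iff.mp (hl L hL) ε hε] with n hn ζ hζ
    simpa [taylorSum, centerSum] using hn (ζ, 0) ⟨hζ, rfl⟩
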